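/- Let $G$ be a finite simple connected graph with $n \ge 2$ vertices, $m$ edges and maximum degree $\Delta$. For $\alpha\in[0,1]$ let $A_\alpha(G)=\alpha D(G)+(1-\alpha)A(G)$, where $A(G)$ is the adjacency matrix and $D(G)$ the diagonal matrix of vertex degrees of $G$; let $\rho_1\ge\rho_2\ge\dots\ge\rho_n$ be the eigenvalues of $A_\alpha(G)$, counted with multiplicity, and let $$E_{A_\alpha}(G)=\sum_{i=1}^n\left|\rho_i-\frac{2\alpha m}{n}\right|$$ be the $A_\alpha$-energy of $G$. If $\frac12<\alpha<1$, then $$E_{A_\alpha}(G)\le\alpha\left(4m-3\Delta-\frac{4m}{n}+1\right)+\sqrt{\alpha^2(\Delta+1)^2+4(1-2\alpha)\Delta}.$$ Moreover, for each such $\alpha$, equality holds if and only if $G$ is isomorphic to the star $K_{1,n-1}$. -/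

import Mathlib

namespace SimpleGraph

variable {V : Type*} [Fintype V] [DecidableEq V]

/-- The matrix `A_α(G) = α D(G) + (1 - α) A(G)`. -/
noncomputable def alphaMatrix (G : SimpleGraph V) [DecidableRel G.Adj] (α : ℝ) : Matrix V V ℝ :=
  α • G.degMatrix ℝ + (1 - α) • G.adjMatrix ℝ

theorem isHermitian_alphaMatrix (G : SimpleGraph V) [DecidableRel G.Adj] (α : ℝ) :
    (G.alphaMatrix α).IsHermitian := by
  have hD : (G.degMatrix ℝ).IsHermitian := by
    rw [Matrix.IsHermitian, Matrix.conjTranspose_eq_transpose_of_trivial]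
    exact Matrix.diagonal_transpose _
  have hA : (G.adjMatrix ℝ).IsHermitian := by
    rw [Matrix.IsHermitian, Matrix.conjTranspose_eq_transpose_of_trivial]
    exact G.isSymm_adjMatrix
  rw [Matrix.IsHermitian, alphaMatrix, Matrix.conjTranspose_add, Matrix.conjTranspose_smul,
    Matrix.conjTranspose_smul, hD.eq, hA.eq, star_trivial, star_trivial]

/-- The `A_α`-energy `∑ |ρ_i - 2αm/n|`, the sum being over the `n` eigenvalues `ρ_i` of `A_α(G)`
counted with multiplicity, where `n` is the order and `m` the size of `G`. -/
noncomputable def alphaEnergy (G : SimpleGraph V) [DecidableRel G.Adj] (α : ℝ) : ℝ :=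
  ∑ i : V, |(G.isHermitian_alphaMatrix α).eigenvalues i
    - 2 * α * (G.edgeFinset.card : ℝ) / (Fintype.card V : ℝ)|

end SimpleGraph

/-! Deviations from the mean sum to zero, so the energy is twice the sum of `ρ_i - 2αm/n` over the
set `I` where this is nonnegative. The quadratic form of `A_α` is a sum of edge forms, nonnegative
for `α ≥ 1/2`. Hence each `ρ_i` dominates the star form at a vertex `u` of degree `Δ`, evaluated at
its eigenvector. The traces of the two forms are `2αm` and `2αΔ`; bounding `ρ_i` below off `I` gives
`∑_I ρ_i ≤ 2α(m - Δ) + ∑_I star`. The star form is at most `α‖x‖²` plus a rank-one form with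
eigenvalue `θ`, so its sum over `I` is at most `α #I + θ` by Bessel (`sum_star_form_le`). Since `2m
≥ n`, the resulting bound is weakest at `#I = 1`, which is the claim. An edge avoiding `u` makes an
inequality strict (`alphaEnergy_lt`), so equality forces a star. For a star, the eigenvalue `θ + α`
alone attains the bound. -/

theorem OrthonormalBasis.sum_apply_mul_apply {V ι : Type*} [Fintype V] [DecidableEq V]
    [Fintype ι] (e : OrthonormalBasis ι ℝ (EuclideanSpace ℝ V)) (a b : V) :
    ∑ i, e i a * e i b = if a = b then 1 else 0 := by
  have h := e.sum_inner_mul_inner (EuclideanSpace.single a 1) (EuclideanSpace.single b 1)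
  simpa [EuclideanSpace.inner_single_left, EuclideanSpace.inner_single_right, eq_comm] using h

theorem OrthonormalBasis.sum_sq_apply {V ι : Type*} [Fintype V]
    [Fintype ι] (e : OrthonormalBasis ι ℝ (EuclideanSpace ℝ V)) (i : ι) :
    ∑ a, e i a ^ 2 = 1 := by
  have h := e.norm_eq_one i
  rw [EuclideanSpace.norm_eq, Real.sqrt_eq_one] at h
  simpa using h

theorem OrthonormalBasis.sum_sq_sum_mul {V ι : Type*} [Fintype V] [Fintype ι]
    (e : OrthonormalBasis ι ℝ (EuclideanSpace ℝ V)) (v : V → ℝ) :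
    ∑ i, (∑ a, v a * e i a) ^ 2 = ∑ a, v a ^ 2 := by
  have h := e.sum_sq_norm_inner_right (WithLp.toLp 2 v)
  rw [EuclideanSpace.norm_sq_eq] at h
  simpa [PiLp.inner_apply] using h

open Finset in
theorem Finset.sum_abs_eq_two_mul_sum_filter {ι : Type*} (s : Finset ι) (f : ι → ℝ)
    (h : ∑ i ∈ s, f i = 0) : ∑ i ∈ s, |f i| = 2 * ∑ i ∈ s with 0 ≤ f i, f i := by
  have h1 : ∑ i ∈ s, |f i| + ∑ i ∈ s, f i = 2 * ∑ i ∈ s with 0 ≤ f i, f i := by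
    rw [← sum_add_distrib, mul_sum, sum_filter]
    refine sum_congr rfl fun i _ => ?_
    split_ifs with hi
    · rw [abs_of_nonneg hi]; ring
    · rw [abs_of_neg (not_le.1 hi)]; ring
  linarith

/-! ### Edge forms and the star at a vertex -/

namespace SimpleGraph

open Finset Matrix

variable {V : Type*}

/-- The contribution of an edge `ab` to the quadratic form of `A_α(G)` at `x`. -/
def alphaEdgeForm (α : ℝ) (x : V → ℝ) (a b : V) : ℝ :=
  α * (x a ^ 2 + x b ^ 2) + 2 * (1 - α) * (x a * x b)

theorem alphaEdgeForm_comm (α : ℝ) (x : V → ℝ) (a b : V) :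
    alphaEdgeForm α x a b = alphaEdgeForm α x b a := by
  unfold alphaEdgeForm; ring

/-- The difference of the two sides is `(1 - α)(x a + x b)²`. -/
theorem le_alphaEdgeForm {α : ℝ} (hα1 : α ≤ 1) (x : V → ℝ) (a b : V) :
    (2 * α - 1) * (x a ^ 2 + x b ^ 2) ≤ alphaEdgeForm α x a b := by
  unfold alphaEdgeForm
  nlinarith [mul_nonneg (sub_nonneg.2 hα1) (sq_nonneg (x a + x b))]

theorem alphaEdgeForm_nonneg {α : ℝ} (hα : 1 / 2 ≤ α) (hα1 : α ≤ 1) (x : V → ℝ) (a b : V) :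
    0 ≤ alphaEdgeForm α x a b :=
  le_trans (mul_nonneg (by linarith) (by positivity)) (le_alphaEdgeForm hα1 x a b)

variable [Fintype V]

theorem Connected.card_le_card_edgeFinset_add_one {G : SimpleGraph V} [DecidableRel G.Adj]
    (hG : G.Connected) : Fintype.card V ≤ #G.edgeFinset + 1 := by
  have h := hG.card_vert_le_card_edgeSet_add_one
  rwa [Nat.card_eq_fintype_card, Nat.card_eq_fintype_card, ← edgeFinset_card] at h

theorem Connected.adj_iff_of_edges_contain {G : SimpleGraph V} (hG : G.Connected)
    (hn : 2 ≤ Fintype.card V) {u : V} (h : ∀ a b, G.Adj a b → a = u ∨ b = u) (a b : V) :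
    G.Adj a b ↔ a ≠ b ∧ (a = u ∨ b = u) := by
  classical
  have : Nontrivial V := Fintype.one_lt_card_iff_nontrivial.1 hn
  have hleaf : ∀ c, c ≠ u → G.Adj c u := fun c hc => by
    obtain ⟨d, hd⟩ := (G.degree_pos_iff_exists_adj c).1 (hG.preconnected.degree_pos_of_nontrivial c)
    rcases h c d hd with h | h
    · exact absurd h hc
    · exact h ▸ hd
  refine ⟨fun hab => ⟨hab.ne, h a b hab⟩, ?_⟩
  rintro ⟨hab, rfl | rfl⟩
  · exact (hleaf b hab.symm).symm
  · exact hleaf a hab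

theorem neighborFinset_leaf {G : SimpleGraph V} [DecidableRel G.Adj] {u : V}
    (hu : ∀ a b, G.Adj a b ↔ a ≠ b ∧ (a = u ∨ b = u)) {a : V} (ha : a ≠ u) :
    G.neighborFinset a = {u} := by
  ext b
  simp only [mem_neighborFinset, hu, ha, false_or, mem_singleton]
  exact ⟨fun h => h.2, fun h => ⟨h ▸ ha, h⟩⟩

variable [DecidableEq V]

theorem alphaMatrix_mulVec_apply (G : SimpleGraph V) [DecidableRel G.Adj] (α : ℝ) (x : V → ℝ)
    (a : V) :
    (G.alphaMatrix α *ᵥ x) a = α * (G.degree a * x a) + (1 - α) * ∑ b ∈ G.neighborFinset a, x b := by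
  simp [alphaMatrix, add_mulVec, smul_mulVec, degMatrix_mulVec_apply, adjMatrix_mulVec_apply]

theorem dotProduct_alphaMatrix_mulVec (G : SimpleGraph V) [DecidableRel G.Adj] (α : ℝ)
    (x : V → ℝ) :
    2 * (x ⬝ᵥ G.alphaMatrix α *ᵥ x) =
      ∑ a, ∑ b, if G.Adj a b then alphaEdgeForm α x a b else 0 := by
  have hdeg : ∑ a, ∑ b, (if G.Adj a b then x a ^ 2 else 0) = ∑ a, G.degree a * x a ^ 2 := by
    refine sum_congr rfl fun a _ => ?_
    rw [← sum_filter, sum_const, nsmul_eq_mul, ← G.neighborFinset_eq_filter,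
      card_neighborFinset_eq_degree]
  have hdeg' : ∑ a, ∑ b, (if G.Adj a b then x b ^ 2 else 0) = ∑ a, G.degree a * x a ^ 2 := by
    rw [sum_comm, ← hdeg]
    simp only [G.adj_comm]
  have hsplit : ∀ a b, (if G.Adj a b then alphaEdgeForm α x a b else 0) =
      α * (if G.Adj a b then x a ^ 2 else 0) + α * (if G.Adj a b then x b ^ 2 else 0) +
        2 * (1 - α) * (x a * if G.Adj a b then x b else 0) := by
    intro a b
    split_ifs
    · unfold alphaEdgeForm; ring
    · simp
  simp only [hsplit, sum_add_distrib, ← mul_sum, hdeg, hdeg']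
  simp only [dotProduct, alphaMatrix_mulVec_apply, G.neighborFinset_eq_filter, sum_filter, mul_add,
    sum_add_distrib]
  simp only [mul_sum, ← sum_add_distrib]
  refine sum_congr rfl fun a _ => ?_
  have : ∑ i, x a * ((1 - α) * if G.Adj a i then x i else 0) =
      (1 - α) * (x a * ∑ i, if G.Adj a i then x i else 0) := by
    simp only [mul_sum]; exact sum_congr rfl fun _ _ => by ring
  simp only [← mul_sum]
  ring

/-- Splitting the quadratic form of `A_α(G)` into the star at `u` and the edges avoiding `u`. -/
theorem dotProduct_alphaMatrix_mulVec_eq_star_add (G : SimpleGraph V) [DecidableRel G.Adj] (α : ℝ)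
    (x : V → ℝ) (u : V) :
    x ⬝ᵥ G.alphaMatrix α *ᵥ x = ∑ b ∈ G.neighborFinset u, alphaEdgeForm α x u b +
      (∑ a, ∑ b, if G.Adj a b ∧ a ≠ u ∧ b ≠ u then alphaEdgeForm α x a b else 0) / 2 := by
  have h := dotProduct_alphaMatrix_mulVec G α x
  have hsplit : ∀ a b, (if G.Adj a b then alphaEdgeForm α x a b else 0) =
      (if a = u then (if G.Adj u b then alphaEdgeForm α x u b else 0) else 0) +
      (if b = u then (if G.Adj u a then alphaEdgeForm α x u a else 0) else 0) +
      (if G.Adj a b ∧ a ≠ u ∧ b ≠ u then alphaEdgeForm α x a b else 0) := by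
    intro a b
    by_cases ha : a = u
    · subst ha
      by_cases hb : b = a
      · subst hb; simp
      · simp [hb]
    · by_cases hb : b = u
      · subst hb; simp [ha, G.adj_comm, alphaEdgeForm_comm α x a]
      · simp [ha, hb]
  rw [sum_congr rfl fun a _ => sum_congr rfl fun b _ => hsplit a b] at h
  simp only [sum_add_distrib] at h
  have h1 : ∑ a, ∑ b, (if a = u then (if G.Adj u b then alphaEdgeForm α x u b else 0) else 0) =
      ∑ b ∈ G.neighborFinset u, alphaEdgeForm α x u b := by
    rw [sum_comm]
    simp [G.neighborFinset_eq_filter, sum_filter]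
  have h2 : ∑ a, ∑ b, (if b = u then (if G.Adj u a then alphaEdgeForm α x u a else 0) else 0) =
      ∑ b ∈ G.neighborFinset u, alphaEdgeForm α x u b := by
    simp [G.neighborFinset_eq_filter, sum_filter]
  rw [h1, h2] at h
  linarith

theorem star_form_le_dotProduct {α : ℝ} (hα : 1 / 2 ≤ α) (hα1 : α ≤ 1) (G : SimpleGraph V)
    [DecidableRel G.Adj] (x : V → ℝ) (u : V) :
    ∑ b ∈ G.neighborFinset u, alphaEdgeForm α x u b ≤ x ⬝ᵥ G.alphaMatrix α *ᵥ x := by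
  rw [dotProduct_alphaMatrix_mulVec_eq_star_add G α x u]
  have : 0 ≤ ∑ a, ∑ b, if G.Adj a b ∧ a ≠ u ∧ b ≠ u then alphaEdgeForm α x a b else 0 :=
    sum_nonneg fun a _ => sum_nonneg fun b _ => by
      split_ifs
      exacts [alphaEdgeForm_nonneg hα hα1 x a b, le_rfl]
  linarith

/-- The factor `1/2` arises from keeping only the ordered pair `(a, b)` of the double sum; any
positive multiple suffices for strictness. -/
theorem star_form_add_edge_le_dotProduct {α : ℝ} (hα : 1 / 2 ≤ α) (hα1 : α ≤ 1) (G : SimpleGraph V)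
    [DecidableRel G.Adj] (x : V → ℝ) {u a b : V} (hab : G.Adj a b) (ha : a ≠ u) (hb : b ≠ u) :
    ∑ b ∈ G.neighborFinset u, alphaEdgeForm α x u b + alphaEdgeForm α x a b / 2 ≤
      x ⬝ᵥ G.alphaMatrix α *ᵥ x := by
  rw [dotProduct_alphaMatrix_mulVec_eq_star_add G α x u]
  have hnn : ∀ a b, 0 ≤ if G.Adj a b ∧ a ≠ u ∧ b ≠ u then alphaEdgeForm α x a b else 0 :=
    fun a b => by
      split_ifs
      exacts [alphaEdgeForm_nonneg hα hα1 x a b, le_rfl]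
  have h1 := single_le_sum (f := fun a => ∑ b, if G.Adj a b ∧ a ≠ u ∧ b ≠ u then
    alphaEdgeForm α x a b else 0) (fun a _ => sum_nonneg fun b _ => hnn a b) (mem_univ a)
  have h2 := single_le_sum (f := fun b => if G.Adj a b ∧ a ≠ u ∧ b ≠ u then
    alphaEdgeForm α x a b else 0) (fun b _ => hnn a b) (mem_univ b)
  simp only [hab, ha, hb, ne_eq, not_false_eq_true, and_self, if_true] at h1 h2
  have := h2.trans h1
  linarith

/-- The star at `u` contributes at most `α ‖x‖²` plus a rank-one form. -/
theorem star_form_le {α θ : ℝ} (hα : 0 ≤ α) (hθ : 0 < θ) (G : SimpleGraph V)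
    [DecidableRel G.Adj] (u : V)
    (hθ2 : θ ^ 2 = α * (G.degree u - 1) * θ + (1 - α) ^ 2 * G.degree u) (x : V → ℝ) :
    ∑ b ∈ G.neighborFinset u, alphaEdgeForm α x u b ≤ α * ∑ a, x a ^ 2 +
      θ / (θ ^ 2 + (1 - α) ^ 2 * G.degree u) *
        (θ * x u + (1 - α) * ∑ b ∈ G.neighborFinset u, x b) ^ 2 := by
  set d : ℝ := (G.degree u : ℝ) with hd
  have hd0 : 0 ≤ d := Nat.cast_nonneg _
  set s := ∑ b ∈ G.neighborFinset u, x b with hs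
  have hform : ∑ b ∈ G.neighborFinset u, alphaEdgeForm α x u b =
      α * d * x u ^ 2 + α * ∑ b ∈ G.neighborFinset u, x b ^ 2 + 2 * (1 - α) * (x u * s) := by
    simp only [alphaEdgeForm, mul_add, sum_add_distrib, ← mul_sum, sum_const, nsmul_eq_mul,
      card_neighborFinset_eq_degree, hs, hd]
    ring
  have hsq : x u ^ 2 + ∑ b ∈ G.neighborFinset u, x b ^ 2 ≤ ∑ a, x a ^ 2 := by
    rw [← sum_insert (f := fun b => x b ^ 2) (G.notMem_neighborFinset_self u)]
    exact sum_le_univ_sum_of_nonneg fun a => sq_nonneg _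
  have hN : 0 < θ ^ 2 + (1 - α) ^ 2 * d := by positivity
  -- Spectral decomposition in `x u` and `s`: besides `θ`, the quadratic has the root `-(1 - α)²d/θ
  -- ≤ 0`, whose square term is dropped.
  have key : θ / (θ ^ 2 + (1 - α) ^ 2 * d) * (θ * x u + (1 - α) * s) ^ 2 -
      (α * (d - 1) * x u ^ 2 + 2 * (1 - α) * (x u * s)) =
      (1 - α) ^ 2 / (θ * (θ ^ 2 + (1 - α) ^ 2 * d)) * ((1 - α) * d * x u - θ * s) ^ 2 := by
    have h : α * (d - 1) = (θ ^ 2 - (1 - α) ^ 2 * d) / θ := by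
      field_simp; linarith
    rw [h]
    field_simp
    ring
  have hpos : 0 ≤ (1 - α) ^ 2 / (θ * (θ ^ 2 + (1 - α) ^ 2 * d)) *
      ((1 - α) * d * x u - θ * s) ^ 2 := by positivity
  rw [hform]
  nlinarith [mul_le_mul_of_nonneg_left hsq hα]

/-! ### Traces and partial sums of eigenvalues -/

theorem trace_alphaMatrix (G : SimpleGraph V) [DecidableRel G.Adj] (α : ℝ) :
    (G.alphaMatrix α).trace = 2 * α * (G.edgeFinset.card : ℝ) := by
  have h : (∑ v, (G.degree v : ℝ)) = 2 * (G.edgeFinset.card : ℝ) := by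
    exact_mod_cast G.sum_degrees_eq_twice_card_edges
  rw [alphaMatrix, trace_add, trace_smul, trace_smul, trace_adjMatrix, degMatrix, trace_diagonal, h]
  simp; ring

theorem sum_eigenvalues_alphaMatrix (G : SimpleGraph V) [DecidableRel G.Adj] (α : ℝ) :
    ∑ i, (G.isHermitian_alphaMatrix α).eigenvalues i = 2 * α * (G.edgeFinset.card : ℝ) := by
  rw [← trace_alphaMatrix, (G.isHermitian_alphaMatrix α).trace_eq_sum_eigenvalues]
  simp

theorem sum_eigenvalues_sub_mean [Nonempty V] (G : SimpleGraph V) [DecidableRel G.Adj] (α : ℝ) :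
    ∑ i, ((G.isHermitian_alphaMatrix α).eigenvalues i -
      2 * α * (G.edgeFinset.card : ℝ) / (Fintype.card V : ℝ)) = 0 := by
  rw [sum_sub_distrib, sum_eigenvalues_alphaMatrix, sum_const, card_univ, nsmul_eq_mul,
    mul_div_cancel₀ _ (by simp), sub_self]

theorem eigenvalues_alphaMatrix_eq_dotProduct (G : SimpleGraph V) [DecidableRel G.Adj] (α : ℝ)
    (i : V) :
    (G.isHermitian_alphaMatrix α).eigenvalues i =
      ((G.isHermitian_alphaMatrix α).eigenvectorBasis i : V → ℝ) ⬝ᵥ G.alphaMatrix α *ᵥ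
        ((G.isHermitian_alphaMatrix α).eigenvectorBasis i : V → ℝ) := by
  rw [(G.isHermitian_alphaMatrix α).eigenvalues_eq i]
  simp

theorem sum_alphaEdgeForm_orthonormalBasis {ι : Type*} [Fintype ι]
    (e : OrthonormalBasis ι ℝ (EuclideanSpace ℝ V)) (α : ℝ) {a b : V} (hab : a ≠ b) :
    ∑ i, alphaEdgeForm α (e i) a b = 2 * α := by
  have ha := e.sum_apply_mul_apply a a
  have hb := e.sum_apply_mul_apply b b
  have h := e.sum_apply_mul_apply a b
  simp only [if_true, if_neg hab, ← pow_two] at ha hb h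
  simp only [alphaEdgeForm, sum_add_distrib, ← mul_sum, ha, hb, h]
  ring

theorem sum_star_form_orthonormalBasis {ι : Type*} [Fintype ι]
    (e : OrthonormalBasis ι ℝ (EuclideanSpace ℝ V)) (α : ℝ) (G : SimpleGraph V)
    [DecidableRel G.Adj] (u : V) :
    ∑ i, ∑ b ∈ G.neighborFinset u, alphaEdgeForm α (e i) u b = 2 * α * G.degree u := by
  rw [sum_comm, sum_congr rfl fun b hb => sum_alphaEdgeForm_orthonormalBasis e α
    ((G.mem_neighborFinset u b).1 hb).ne, sum_const, card_neighborFinset_eq_degree, nsmul_eq_mul]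
  ring

/-- Summing the quadratic form of the star at `u` over part of an orthonormal basis. -/
theorem sum_star_form_le {α θ : ℝ} (hα : 0 ≤ α) (hθ : 0 < θ) (G : SimpleGraph V)
    [DecidableRel G.Adj] (u : V)
    (hθ2 : θ ^ 2 = α * (G.degree u - 1) * θ + (1 - α) ^ 2 * G.degree u)
    {ι : Type*} [Fintype ι] (e : OrthonormalBasis ι ℝ (EuclideanSpace ℝ V)) (I : Finset ι) :
    ∑ i ∈ I, ∑ b ∈ G.neighborFinset u, alphaEdgeForm α (e i) u b ≤ α * #I + θ := by
  have hN : 0 < θ ^ 2 + (1 - α) ^ 2 * G.degree u := by positivity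
  -- The vector defining the rank-one form. Its squared norm cancels the denominator after Bessel,
  -- so `θ` is paid once, whatever `#I` is.
  let v : V → ℝ := fun a => if a = u then θ else if G.Adj u a then 1 - α else 0
  have hv (y : V → ℝ) (w : ℝ → ℝ) (hw : w 0 = 0) : ∑ a, w (v a) * y a =
      w θ * y u + w (1 - α) * ∑ b ∈ G.neighborFinset u, y b := by
    have h : ∀ a, w (v a) * y a = (if a = u then w θ * y a else 0) +
        if G.Adj u a then w (1 - α) * y a else 0 := by
      intro a
      by_cases ha : a = u
      · subst ha; simp [v]
      · by_cases hb : G.Adj u a <;> simp [v, ha, hb, hw]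
    rw [sum_congr rfl fun a _ => h a, sum_add_distrib, G.neighborFinset_eq_filter, mul_sum,
      sum_filter]
    simp
  have hvsq : ∑ a, v a ^ 2 = θ ^ 2 + (1 - α) ^ 2 * G.degree u := by
    simpa using hv (fun _ => 1) (fun t => t ^ 2) (by simp)
  have hbessel : ∑ i ∈ I, (θ * e i u + (1 - α) * ∑ b ∈ G.neighborFinset u, e i b) ^ 2 ≤
      θ ^ 2 + (1 - α) ^ 2 * G.degree u := by
    rw [← hvsq, ← e.sum_sq_sum_mul v]
    calc _ = ∑ i ∈ I, (∑ a, v a * e i a) ^ 2 :=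
          sum_congr rfl fun i _ => congrArg (· ^ 2) (hv (e i) id rfl).symm
      _ ≤ _ := sum_le_univ_sum_of_nonneg fun i => sq_nonneg _
  calc _ ≤ ∑ i ∈ I, (α * ∑ a, e i a ^ 2 + θ / (θ ^ 2 + (1 - α) ^ 2 * G.degree u) *
        (θ * e i u + (1 - α) * ∑ b ∈ G.neighborFinset u, e i b) ^ 2) :=
        sum_le_sum fun i _ => star_form_le hα hθ G u hθ2 (e i)
    _ = α * #I + θ / (θ ^ 2 + (1 - α) ^ 2 * G.degree u) *
        ∑ i ∈ I, (θ * e i u + (1 - α) * ∑ b ∈ G.neighborFinset u, e i b) ^ 2 := by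
        simp only [e.sum_sq_apply, sum_add_distrib, ← mul_sum, sum_const, nsmul_eq_mul, mul_one]
        ring
    _ ≤ α * #I + θ / (θ ^ 2 + (1 - α) ^ 2 * G.degree u) *
        (θ ^ 2 + (1 - α) ^ 2 * G.degree u) := by gcongr
    _ = α * #I + θ := by rw [div_mul_cancel₀ _ hN.ne']

/-- The bound on a partial sum of eigenvalues, with the defect coming from the eigenvectors left
out. -/
theorem sum_eigenvalues_add_defect_le {α θ : ℝ} (hα : 0 ≤ α) (hθ : 0 < θ) (G : SimpleGraph V)
    [DecidableRel G.Adj] (u : V)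
    (hθ2 : θ ^ 2 = α * (G.degree u - 1) * θ + (1 - α) ^ 2 * G.degree u) (I : Finset V) :
    ∑ i ∈ I, (G.isHermitian_alphaMatrix α).eigenvalues i +
      ∑ i ∈ Iᶜ, ((G.isHermitian_alphaMatrix α).eigenvalues i -
        ∑ b ∈ G.neighborFinset u,
          alphaEdgeForm α ((G.isHermitian_alphaMatrix α).eigenvectorBasis i) u b) ≤
      α * #I + θ + 2 * α * (G.edgeFinset.card - G.degree u : ℝ) := by
  have h1 := sum_star_form_le hα hθ G u hθ2 (G.isHermitian_alphaMatrix α).eigenvectorBasis I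
  have h2 := sum_star_form_orthonormalBasis (G.isHermitian_alphaMatrix α).eigenvectorBasis α G u
  have h3 := sum_eigenvalues_alphaMatrix G α
  rw [← sum_add_sum_compl I] at h2 h3
  rw [sum_sub_distrib]
  linarith

theorem star_form_le_eigenvalues {α : ℝ} (hα : 1 / 2 ≤ α) (hα1 : α ≤ 1) (G : SimpleGraph V)
    [DecidableRel G.Adj] (u i : V) :
    ∑ b ∈ G.neighborFinset u,
      alphaEdgeForm α ((G.isHermitian_alphaMatrix α).eigenvectorBasis i) u b ≤
        (G.isHermitian_alphaMatrix α).eigenvalues i := by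
  rw [eigenvalues_alphaMatrix_eq_dotProduct]
  exact star_form_le_dotProduct hα hα1 G _ u

/-- If some edge avoids `u`, then for any `j` there is an eigenvector other than the `j`-th at which
the quadratic form of `A_α(G)` exceeds that of the star at `u`. -/
theorem exists_mem_compl_star_form_lt {α : ℝ} (hα : 1 / 2 < α) (hα1 : α ≤ 1) (G : SimpleGraph V)
    [DecidableRel G.Adj] {u a b : V} (hab : G.Adj a b) (ha : a ≠ u) (hb : b ≠ u) (j : V) :
    ∃ i ∈ ({j} : Finset V)ᶜ, ∑ b ∈ G.neighborFinset u,
      alphaEdgeForm α ((G.isHermitian_alphaMatrix α).eigenvectorBasis i) u b <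
        (G.isHermitian_alphaMatrix α).eigenvalues i := by
  set e := (G.isHermitian_alphaMatrix α).eigenvectorBasis
  by_contra! hcon
  have hzero : ∀ i, i ≠ j → e i a = 0 ∧ e i b = 0 := by
    intro i hi
    have h1 := hcon i (by simpa using hi)
    rw [eigenvalues_alphaMatrix_eq_dotProduct] at h1
    have h2 := star_form_add_edge_le_dotProduct hα.le hα1 G (e i) hab ha hb
    have h3 := le_alphaEdgeForm hα1 (e i) a b
    have h4 : (2 * α - 1) * (e i a ^ 2 + e i b ^ 2) ≤ 0 := by linarith
    have h5 : e i a ^ 2 + e i b ^ 2 ≤ 0 := by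
      by_contra! h
      exact absurd h4 (not_le.2 (mul_pos (by linarith) h))
    constructor <;> nlinarith [sq_nonneg (e i a), sq_nonneg (e i b)]
  -- Columns of an orthogonal matrix are unit vectors too, so the unit vector `e j` would have two
  -- entries of square `1`.
  have hcol : ∀ c, (∀ i, i ≠ j → e i c = 0) → e j c ^ 2 = 1 := by
    intro c hc
    have h := e.sum_apply_mul_apply c c
    rw [sum_eq_single j (fun i _ hi => by simp [hc i hi]) (by simp), if_pos rfl] at h
    rw [pow_two, h]
  have h1 := hcol a fun i hi => (hzero i hi).1
  have h2 := hcol b fun i hi => (hzero i hi).2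
  have h3 : ∑ c ∈ {a, b}, e j c ^ 2 ≤ ∑ c, e j c ^ 2 :=
    sum_le_univ_sum_of_nonneg fun c => sq_nonneg _
  rw [e.sum_sq_apply, sum_pair hab.ne, h1, h2] at h3
  norm_num at h3

/-! ### Bounds on the energy -/

theorem alphaEnergy_eq_two_mul_sum [Nonempty V] (G : SimpleGraph V) [DecidableRel G.Adj] (α : ℝ) :
    ∃ I : Finset V, I.Nonempty ∧ G.alphaEnergy α =
      2 * (∑ i ∈ I, (G.isHermitian_alphaMatrix α).eigenvalues i -
        #I * (2 * α * (G.edgeFinset.card : ℝ) / (Fintype.card V : ℝ))) := by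
  refine ⟨univ.filter fun i => 0 ≤ (G.isHermitian_alphaMatrix α).eigenvalues i -
    2 * α * (G.edgeFinset.card : ℝ) / (Fintype.card V : ℝ), ?_, ?_⟩
  · obtain ⟨i, -, hi⟩ := exists_le_of_sum_le univ_nonempty
      (show ∑ i : V, (0 : ℝ) ≤ ∑ i, _ by rw [sum_eigenvalues_sub_mean G α, sum_const_zero])
    exact ⟨i, by simpa using hi⟩
  · rw [alphaEnergy, sum_abs_eq_two_mul_sum_filter _ _ (sum_eigenvalues_sub_mean G α),
      sum_sub_distrib, sum_const, nsmul_eq_mul]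

theorem alphaEnergy_le {α θ : ℝ} (hα : 1 / 2 < α) (hα1 : α ≤ 1) (hθ : 0 < θ) (G : SimpleGraph V)
    [DecidableRel G.Adj] (hG : G.Connected) (hn : 2 ≤ Fintype.card V) (u : V)
    (hθ2 : θ ^ 2 = α * (G.degree u - 1) * θ + (1 - α) ^ 2 * G.degree u) :
    G.alphaEnergy α ≤ 2 * (θ + α + 2 * α * (G.edgeFinset.card - G.degree u : ℝ) -
      2 * α * (G.edgeFinset.card : ℝ) / (Fintype.card V : ℝ)) := by
  have := hG.nonempty
  obtain ⟨I, hI, hE⟩ := alphaEnergy_eq_two_mul_sum G α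
  have h1 := sum_eigenvalues_add_defect_le (by linarith) hθ G u hθ2 I
  have h2 := sum_nonneg fun i (_ : i ∈ Iᶜ) =>
    sub_nonneg.2 (star_form_le_eigenvalues hα.le hα1 G u i)
  -- Each further index in `I` adds `α` minus the mean to the bound, which is not positive.
  have hc : α ≤ 2 * α * (G.edgeFinset.card : ℝ) / (Fintype.card V : ℝ) := by
    have h : (Fintype.card V : ℝ) ≤ 2 * G.edgeFinset.card := by
      have := hG.card_le_card_edgeFinset_add_one
      exact_mod_cast (by omega : Fintype.card V ≤ 2 * #G.edgeFinset)
    rw [le_div_iff₀ (by positivity)]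
    nlinarith
  have hk : (1 : ℝ) ≤ #I := by exact_mod_cast hI.card_pos
  rw [hE]
  nlinarith [mul_nonneg (sub_nonneg.2 hk) (sub_nonneg.2 hc)]

theorem alphaEnergy_lt {α θ : ℝ} (hα : 1 / 2 < α) (hα1 : α ≤ 1) (hθ : 0 < θ) (G : SimpleGraph V)
    [DecidableRel G.Adj] (hG : G.Connected) {u a b : V}
    (hab : G.Adj a b) (ha : a ≠ u) (hb : b ≠ u)
    (hθ2 : θ ^ 2 = α * (G.degree u - 1) * θ + (1 - α) ^ 2 * G.degree u) :
    G.alphaEnergy α < 2 * (θ + α + 2 * α * (G.edgeFinset.card - G.degree u : ℝ) -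
      2 * α * (G.edgeFinset.card : ℝ) / (Fintype.card V : ℝ)) := by
  have := hG.nonempty
  have hn : 3 ≤ Fintype.card V := by
    have h : #{a, b, u} = 3 := card_eq_three.2 ⟨a, b, u, hab.ne, ha, hb, rfl⟩
    rw [← h]
    exact card_le_univ _
  obtain ⟨I, hI, hE⟩ := alphaEnergy_eq_two_mul_sum G α
  have h1 := sum_eigenvalues_add_defect_le (by linarith) hθ G u hθ2 I
  have h2 := fun i (_ : i ∈ Iᶜ) =>
    sub_nonneg.2 (star_form_le_eigenvalues hα.le hα1 G u i)
  have hc : α < 2 * α * (G.edgeFinset.card : ℝ) / (Fintype.card V : ℝ) := by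
    have h : (Fintype.card V : ℝ) < 2 * G.edgeFinset.card := by
      have := hG.card_le_card_edgeFinset_add_one
      exact_mod_cast (by omega : Fintype.card V < 2 * #G.edgeFinset)
    rw [lt_div_iff₀ (by positivity)]
    nlinarith
  rw [hE]
  -- For `#I = 1` the defect off `I` is positive; for `#I ≥ 2` strictness comes from `hc`, where `n
  -- ≥ 3` gives `2m > n`.
  rcases eq_or_lt_of_le (Nat.succ_le_of_lt hI.card_pos) with hk | hk
  · obtain ⟨j, rfl⟩ := card_eq_one.1 hk.symm
    obtain ⟨i, hi, hlt⟩ := exists_mem_compl_star_form_lt hα hα1 G hab ha hb j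
    have h3 := sum_pos' h2 ⟨i, hi, sub_pos.2 hlt⟩
    simp only [card_singleton, Nat.cast_one] at h1 ⊢
    linarith
  · have hk' : (1 : ℝ) < #I := by exact_mod_cast hk
    nlinarith [mul_pos (sub_pos.2 hk') (sub_pos.2 hc), sum_nonneg h2]

/-- The other deviations sum to the negative of this one, so they contribute at least as much again.
-/
theorem two_mul_sub_le_alphaEnergy [Nonempty V] (G : SimpleGraph V) [DecidableRel G.Adj] (α : ℝ)
    {μ : ℝ} (hμ : μ ∈ spectrum ℝ (G.alphaMatrix α)) :
    2 * (μ - 2 * α * (G.edgeFinset.card : ℝ) / (Fintype.card V : ℝ)) ≤ G.alphaEnergy α := by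
  rw [(G.isHermitian_alphaMatrix α).spectrum_real_eq_range_eigenvalues] at hμ
  obtain ⟨i, rfl⟩ := hμ
  have h := sum_eigenvalues_sub_mean G α
  rw [← add_sum_erase _ _ (mem_univ i)] at h
  rw [alphaEnergy, ← add_sum_erase _ _ (mem_univ i)]
  have h1 := neg_le_of_abs_le (abs_sum_le_sum_abs (fun i =>
    (G.isHermitian_alphaMatrix α).eigenvalues i -
      2 * α * (G.edgeFinset.card : ℝ) / (Fintype.card V : ℝ)) (univ.erase i))
  have h2 := le_abs_self ((G.isHermitian_alphaMatrix α).eigenvalues i -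
      2 * α * (G.edgeFinset.card : ℝ) / (Fintype.card V : ℝ))
  linarith

/-! ### Stars -/

section Star

variable {G : SimpleGraph V} [DecidableRel G.Adj] {u : V}

theorem neighborFinset_center (hu : ∀ a b, G.Adj a b ↔ a ≠ b ∧ (a = u ∨ b = u)) :
    G.neighborFinset u = univ.erase u := by
  ext b; simp [hu, eq_comm]

theorem card_edgeFinset_star (hu : ∀ a b, G.Adj a b ↔ a ≠ b ∧ (a = u ∨ b = u)) :
    #G.edgeFinset = G.degree u := by
  have h := G.sum_degrees_eq_twice_card_edges
  have h1 : ∀ a ∈ univ.erase u, G.degree a = 1 := fun a ha => by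
    rw [← card_neighborFinset_eq_degree, neighborFinset_leaf hu (ne_of_mem_erase ha),
      card_singleton]
  rw [← add_sum_erase _ _ (mem_univ u), sum_congr rfl h1, sum_const, ← neighborFinset_center hu,
    card_neighborFinset_eq_degree] at h
  simp only [smul_eq_mul, mul_one] at h
  omega

theorem mem_spectrum_alphaMatrix_star {α θ : ℝ} (hθ : 0 < θ)
    (hu : ∀ a b, G.Adj a b ↔ a ≠ b ∧ (a = u ∨ b = u))
    (hθ2 : θ ^ 2 = α * (G.degree u - 1) * θ + (1 - α) ^ 2 * G.degree u) :
    θ + α ∈ spectrum ℝ (G.alphaMatrix α) := by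
  let v : V → ℝ := fun a => if a = u then θ else 1 - α
  have hv : G.alphaMatrix α *ᵥ v = (θ + α) • v := by
    ext a
    rw [alphaMatrix_mulVec_apply]
    by_cases ha : a = u
    · subst ha
      have h : ∑ b ∈ G.neighborFinset a, v b = G.degree a * (1 - α) := by
        rw [← card_neighborFinset_eq_degree, ← nsmul_eq_mul, ← sum_const]
        exact sum_congr rfl fun b hb => if_neg ((G.mem_neighborFinset a b).1 hb).ne'
      rw [h]
      simp only [v, if_true, Pi.smul_apply, smul_eq_mul]
      linear_combination -hθ2
    · rw [← card_neighborFinset_eq_degree, neighborFinset_leaf hu ha]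
      simp [v, ha]
      ring
  rw [← Matrix.spectrum_toLin']
  refine Module.End.HasEigenvalue.mem_spectrum
    (Module.End.hasEigenvalue_of_hasEigenvector (x := v) ⟨?_, ?_⟩)
  · rw [Module.End.mem_eigenspace_iff, Matrix.toLin'_apply, hv]
  · intro h
    have := congrFun h u
    simp [v, hθ.ne'] at this

end Star

theorem nonempty_iso_completeBipartiteGraph_one_iff (G : SimpleGraph V) {n : ℕ}
    (hn : n = Fintype.card V) :
    Nonempty (G ≃g completeBipartiteGraph (Fin 1) (Fin (n - 1))) ↔
      ∃ u, ∀ a b, G.Adj a b ↔ a ≠ b ∧ (a = u ∨ b = u) := by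
  constructor
  · rintro ⟨f⟩
    refine ⟨f.symm (Sum.inl 0), fun a b => ?_⟩
    rw [← f.map_adj_iff, ← f.injective.ne_iff, RelIso.eq_symm_apply, RelIso.eq_symm_apply]
    generalize f a = x
    generalize f b = y
    rcases x with x | x <;> rcases y with y | y <;>
      simp [completeBipartiteGraph, Subsingleton.elim _ (0 : Fin 1)]
  · rintro ⟨u, hu⟩
    have hcard : Fintype.card {a // ¬ a = u} = n - 1 := by
      rw [Fintype.card_subtype_compl, Fintype.card_subtype_eq, hn]
    let e : V ≃ Fin 1 ⊕ Fin (n - 1) := (Equiv.sumCompl (· = u)).symm.trans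
      (Equiv.sumCongr (Equiv.ofUnique _ _) (Fintype.equivFinOfCardEq hcard))
    have hl : ∀ a, (e a).isLeft ↔ a = u := fun a => by
      by_cases ha : a = u
      · subst ha; simp [e]
      · simp [e, ha, Equiv.sumCompl_symm_apply_of_neg]
    refine ⟨⟨e, fun {a b} => ?_⟩⟩
    rw [hu, completeBipartiteGraph_adj]
    simp only [← Sum.not_isLeft, hl]
    grind

end SimpleGraph

/-! ### The main theorem -/

open SimpleGraph

theorem theorem3p4 {V : Type*} [Fintype V] [DecidableEq V] (G : SimpleGraph V)
    [DecidableRel G.Adj] (hG : G.Connected) (n m Δ : ℕ)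
    (hn : n = Fintype.card V) (hm : m = G.edgeFinset.card) (hΔ : Δ = G.maxDegree)
    (hn2 : 2 ≤ n) (α : ℝ) (hα : 1 / 2 < α) (hα1 : α < 1) :
    G.alphaEnergy α ≤
        α * (4 * (m : ℝ) - 3 * (Δ : ℝ) - 4 * (m : ℝ) / (n : ℝ) + 1)
          + √(α ^ 2 * ((Δ : ℝ) + 1) ^ 2 + 4 * (1 - 2 * α) * (Δ : ℝ)) ∧
    (G.alphaEnergy α =
        α * (4 * (m : ℝ) - 3 * (Δ : ℝ) - 4 * (m : ℝ) / (n : ℝ) + 1)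
          + √(α ^ 2 * ((Δ : ℝ) + 1) ^ 2 + 4 * (1 - 2 * α) * (Δ : ℝ)) ↔
      Nonempty (G ≃g completeBipartiteGraph (Fin 1) (Fin (n - 1)))) := by
  have hne := hG.nonempty
  have hn2' : 2 ≤ Fintype.card V := hn ▸ hn2
  have : Nontrivial V := Fintype.one_lt_card_iff_nontrivial.1 hn2'
  set D : ℝ := α ^ 2 * ((Δ : ℝ) + 1) ^ 2 + 4 * (1 - 2 * α) * (Δ : ℝ) with hD
  -- The positive root of the quadratic in `hθ2`, whose discriminant is `D` by `hDeq`.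
  set θ : ℝ := (α * (Δ - 1) + √D) / 2 with hθdef
  have hΔ1 : (1 : ℝ) ≤ Δ := by
    obtain ⟨v, hv⟩ := G.exists_maximal_degree_vertex
    rw [hΔ, hv]
    exact_mod_cast hG.preconnected.degree_pos_of_nontrivial v
  have hDeq : D = α ^ 2 * ((Δ : ℝ) - 1) ^ 2 + 4 * ((1 - α) ^ 2 * Δ) := by rw [hD]; ring
  have hD0 : 0 < D := by
    have : 0 < (1 - α) ^ 2 * Δ := mul_pos (pow_pos (by linarith) 2) (by linarith)
    rw [hDeq]; positivity
  have hθ : 0 < θ := by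
    have := Real.sqrt_pos.2 hD0
    have : 0 ≤ α * (Δ - 1) := mul_nonneg (by linarith) (by linarith)
    rw [hθdef]; linarith
  have hθ2 : θ ^ 2 = α * (Δ - 1) * θ + (1 - α) ^ 2 * Δ := by
    have := Real.sq_sqrt hD0.le
    rw [hθdef]; linear_combination this / 4 + hDeq / 4
  have hbound : α * (4 * (m : ℝ) - 3 * (Δ : ℝ) - 4 * (m : ℝ) / (n : ℝ) + 1) + √D =
      2 * (θ + α + 2 * α * (m - Δ : ℝ) - 2 * α * (m : ℝ) / (n : ℝ)) := by
    rw [hθdef]; ring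
  rw [hbound, nonempty_iso_completeBipartiteGraph_one_iff G hn]
  obtain ⟨w, hw⟩ := G.exists_maximal_degree_vertex
  have hle : ∀ u, G.degree u = Δ → G.alphaEnergy α ≤
      2 * (θ + α + 2 * α * (m - Δ : ℝ) - 2 * α * (m : ℝ) / (n : ℝ)) := fun u hu => by
    have := alphaEnergy_le hα hα1.le hθ G hG hn2' u (by rwa [hu])
    rwa [hu, ← hn, ← hm] at this
  have hwΔ : G.degree w = Δ := by rw [hΔ, hw]
  refine ⟨hle w hwΔ, fun heq => ⟨w, hG.adj_iff_of_edges_contain hn2' fun a b hab => ?_⟩, ?_⟩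
  · by_contra! hcon
    have := alphaEnergy_lt hα hα1.le hθ G hG hab hcon.1 hcon.2 (by rwa [hwΔ])
    rw [hwΔ, ← hn, ← hm] at this
    exact this.ne heq
  · rintro ⟨u, hu⟩
    have huΔ : G.degree u = Δ := by
      refine le_antisymm (hΔ ▸ G.degree_le_maxDegree u) ?_
      rw [← card_neighborFinset_eq_degree, neighborFinset_center hu, Finset.card_erase_of_mem
        (Finset.mem_univ u), Finset.card_univ, ← hwΔ]
      exact Nat.le_sub_one_of_lt (G.degree_lt_card_verts w)
    refine le_antisymm (hle u huΔ) ?_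
    have h := two_mul_sub_le_alphaEnergy G α
      (mem_spectrum_alphaMatrix_star hθ hu (by rwa [huΔ]))
    rw [← hn, ← hm] at h
    have hmΔ : (m : ℝ) = Δ := by rw [hm, card_edgeFinset_star hu, huΔ]
    rw [hmΔ] at h ⊢
    linarith
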